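/- Let $m\ge 0$ be an integer and let $K\subset\mathbb{R}^m$ be a strictly convex body, that is, a compact convex set with non-empty interior such that for any two distinct points of $K$ the open segment between them lies in $\operatorname{int}K$. An affine diameter of $K$ is an affine line $\ell+v$ (where $\ell\subset\mathbb{R}^m$ is a line through the origin and $v\in\mathbb{R}^m$) such that $$\operatorname{length}(K\cap(\ell+v))=\max\{\operatorname{length}(K\cap(\ell+u)) : u\in\mathbb{R}^m\}.$$ Then there exists a continuous map $f_K\colon\mathbb{R}\mathrm{P}^m\to S^m$ with the following property. For every integer $k\ge 2$: if there are $k$ pairwise distinct points $x_1,\dots,x_k\in\mathbb{R}\mathrm{P}^m$ with $f_K(x_1)=\dots=f_K(x_k)$, then there are $k$ pairwise distinct affine diameters $\ell_1+v_1,\dots,\ell_k+v_k$ of $K$ such that $$(\ell_1+v_1)\cap\dots\cap(\ell_k+v_k)\cap\operatorname{int}K\neq\emptyset .$$ -/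

import Mathlib

open scoped LinearAlgebra.Projectivization

/-- Real projective space of dimension `m`: the lines through the origin of `ℝ^(m+1)`. -/
def RealProjectiveSpace (m : ℕ) : Type :=
  ℙ ℝ (EuclideanSpace ℝ (Fin (m + 1)))

/-- The quotient topology with respect to the projection `v ↦ span {v}` from the nonzero vectors
of `ℝ^(m+1)`. -/
noncomputable instance RealProjectiveSpace.instTopologicalSpace (m : ℕ) :
    TopologicalSpace (RealProjectiveSpace m) :=
  TopologicalSpace.coinduced
    (Projectivization.mk' ℝ :
      {v : EuclideanSpace ℝ (Fin (m + 1)) // v ≠ 0} → ℙ ℝ (EuclideanSpace ℝ (Fin (m + 1))))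
    inferInstance

/-- The map `f` admits a `k`-multiplicity: there are `k` pairwise distinct points with the same
image. -/
def AdmitsMultiplicity {X Y : Type*} (f : X → Y) (k : ℕ) : Prop :=
  ∃ x : Fin k → X, Function.Injective x ∧ ∀ i j, f (x i) = f (x j)

/-- A convex body: a compact convex subset of `ℝ^m` with non-empty interior. -/
structure IsConvexBody {m : ℕ} (K : Set (EuclideanSpace ℝ (Fin m))) : Prop where
  convex : Convex ℝ K
  isCompact : IsCompact K
  nonempty_interior : (interior K).Nonempty

/-- The affine line `ℓ + v`, where `ℓ` is a line through the origin. -/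
noncomputable def lineThrough {m : ℕ} (ℓ : ℙ ℝ (EuclideanSpace ℝ (Fin m))) (v : EuclideanSpace ℝ (Fin m)) :
    AffineSubspace ℝ (EuclideanSpace ℝ (Fin m)) :=
  AffineSubspace.mk' v ℓ.submodule

/-- The length of `K ∩ L`. For a compact convex `K` and a line `L` the set `K ∩ L` is empty or a
compact segment, whose length is its diameter (and `0` if it is empty). -/
noncomputable def chordLength {m : ℕ} (K : Set (EuclideanSpace ℝ (Fin m)))
    (L : AffineSubspace ℝ (EuclideanSpace ℝ (Fin m))) : ℝ :=
  Metric.diam (K ∩ (L : Set (EuclideanSpace ℝ (Fin m))))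

/-- `L` is an affine diameter of `K` in direction `ℓ`: an affine line `ℓ + v` for which the length
of `K ∩ (ℓ + v)` is the maximum of the lengths of `K ∩ (ℓ + u)` over all `u ∈ ℝ^m`. -/
def IsAffineDiameterInDirection {m : ℕ} (K : Set (EuclideanSpace ℝ (Fin m)))
    (ℓ : ℙ ℝ (EuclideanSpace ℝ (Fin m)))
    (L : AffineSubspace ℝ (EuclideanSpace ℝ (Fin m))) : Prop :=
  ∃ v : EuclideanSpace ℝ (Fin m), L = lineThrough ℓ v ∧
    ∀ u : EuclideanSpace ℝ (Fin m), chordLength K (lineThrough ℓ u) ≤ chordLength K L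

/-- `L` is an affine diameter of `K`, in some direction. -/
def IsAffineDiameter {m : ℕ} (K : Set (EuclideanSpace ℝ (Fin m)))
    (L : AffineSubspace ℝ (EuclideanSpace ℝ (Fin m))) : Prop :=
  ∃ ℓ : ℙ ℝ (EuclideanSpace ℝ (Fin m)), IsAffineDiameterInDirection K ℓ L

/-!
For a direction `u`, strict convexity of `K` makes the longest chord of `K` parallel to `u` unique
(`IsLongestChord.left_unique`); it spans the affine diameter in direction `u`
(`IsLongestChord.isAffineDiameter`), and it depends continuously on `u` because the longest chords
form a closed relation with values in the compact set `K × K`.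

Write a point of `ℝP^m` as `[s : x]` with `s ∈ ℝ` and `x ∈ ℝ^m`. Off the axis `x = 0`, the
normalized coordinate `s / ‖(s, x)‖ ∈ (-1, 1)` parametrizes the open longest chord in direction `x`.
Changing the sign of `(s, x)` reverses both the chord and the parameter, so this gives a map from
`ℝP^m` minus one point to `interior K`. As `x → 0` the parameter tends to `±1` and the image
approaches the boundary of `K`. The one-point compactification of `interior K` is a sphere, by the
embedding `collapse`, and sending the missing point `[1 : 0]` to the point at infinity yields the
required continuous map `f` (`exists_continuousMap`).

Infinity has a single preimage, so if `k ≥ 2` distinct points have the same image, they come from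
points on longest chords that agree as points of `interior K`. On a single chord the parameter
determines the point of `ℝP^m` (`mk_eq_mk_of_chordPoint_eq`), so the `k` chords lie on distinct
affine diameters, all passing through that interior point. Collapsing the whole boundary is what
makes the argument work for bodies with corners, where many affine diameters may share an end point.
-/

open scoped Pointwise
open Topology

/-! ### Longest chords of a strictly convex body -/

section LongestChord

variable {E : Type*} [NormedAddCommGroup E] [NormedSpace ℝ E] {K : Set E}

/-- The ordered pair `(a, b)` spans a longest chord of `K` in the direction `a - b`. For compact
convex `K` with non-empty interior, `gauge (K - K) w` is the least `t ≥ 0` such that `w` is `t`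
times a difference of two points of `K`, so the value `1` at `a - b` says exactly that no chord of
`K` parallel to `a - b` is longer. -/
structure IsLongestChord (K : Set E) (a b : E) : Prop where
  left_mem : a ∈ K
  right_mem : b ∈ K
  gauge_eq_one : gauge (K - K) (a - b) = 1

lemma gauge_sub_self_neg (K : Set E) (x : E) : gauge (K - K) (-x) = gauge (K - K) x :=
  gauge_neg (fun y hy => by rw [← Set.mem_neg, neg_sub]; exact hy) x

lemma sub_self_mem_nhds_zero {E : Type*} [NormedAddCommGroup E] {K : Set E}
    (hne : (interior K).Nonempty) : K - K ∈ 𝓝 (0 : E) := by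
  obtain ⟨c, hc⟩ := hne
  have h : (fun y => y + c) ⁻¹' K ∈ 𝓝 (0 : E) := by
    apply (continuous_add_const c).continuousAt.preimage_mem_nhds
    simpa using mem_interior_iff_mem_nhds.1 hc
  filter_upwards [h] with y hy
  exact ⟨y + c, hy, c, interior_subset hc, by simp⟩

lemma IsLongestChord.swap {a b : E} (h : IsLongestChord K a b) : IsLongestChord K b a :=
  ⟨h.right_mem, h.left_mem, by rw [← neg_sub a b, gauge_sub_self_neg]; exact h.gauge_eq_one⟩

lemma IsLongestChord.ne {a b : E} (h : IsLongestChord K a b) : a ≠ b := by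
  rintro rfl
  simpa using h.gauge_eq_one

/-- An end point of a longest chord lies on the boundary: otherwise the chord could be
prolonged. -/
lemma IsLongestChord.left_notMem_interior {a b : E} (h : IsLongestChord K a b) :
    a ∉ interior K := by
  intro ha
  have hcont : Continuous fun t : ℝ => a + t • (a - b) := by fun_prop
  have hnhds : ∀ᶠ t : ℝ in 𝓝 0, a + t • (a - b) ∈ K :=
    hcont.continuousAt.preimage_mem_nhds (by simpa using mem_interior_iff_mem_nhds.1 ha)
  have hev : ∀ᶠ t : ℝ in 𝓝[>] 0, a + t • (a - b) ∈ K := hnhds.filter_mono nhdsWithin_le_nhds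
  obtain ⟨t, ht, ht0⟩ := (hev.and self_mem_nhdsWithin).exists
  have ht0 : 0 < t := ht0
  have hle : gauge (K - K) ((1 + t) • (a - b)) ≤ 1 :=
    gauge_le_one_of_mem ⟨_, ht, b, h.right_mem, by simp only; module⟩
  rw [gauge_smul_of_nonneg (by positivity), h.gauge_eq_one, smul_eq_mul] at hle
  linarith

lemma IsLongestChord.right_notMem_interior {a b : E} (h : IsLongestChord K a b) :
    b ∉ interior K :=
  h.swap.left_notMem_interior

/-- In a strictly convex set a longest chord is determined by its direction: averaging two
distinct parallel longest chords gives a longest chord with an interior end point. -/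
lemma IsLongestChord.left_unique (hs : StrictConvex ℝ K) {a b a' b' : E}
    (h : IsLongestChord K a b) (h' : IsLongestChord K a' b') (hab : a - b = a' - b') :
    a = a' := by
  by_contra hne
  have hmid : (1 / 2 : ℝ) • a + (1 / 2 : ℝ) • a' ∈ interior K :=
    hs h.left_mem h'.left_mem hne (by norm_num) (by norm_num) (by norm_num)
  have hmid' : (1 / 2 : ℝ) • b + (1 / 2 : ℝ) • b' ∈ K :=
    hs.convex h.right_mem h'.right_mem (by norm_num) (by norm_num) (by norm_num)
  refine (IsLongestChord.left_notMem_interior (K := K) ⟨interior_subset hmid, hmid', ?_⟩) hmid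
  have : (1 / 2 : ℝ) • a + (1 / 2 : ℝ) • a' - ((1 / 2 : ℝ) • b + (1 / 2 : ℝ) • b')
      = (1 / 2 : ℝ) • (a - b) + (1 / 2 : ℝ) • (a' - b') := by module
  rw [this, ← hab, ← add_smul]
  norm_num [h.gauge_eq_one]

lemma isCompact_sub_self {E : Type*} [NormedAddCommGroup E] {K : Set E} (hc : IsCompact K) :
    IsCompact (K - K) := by
  simpa [sub_eq_add_neg] using hc.add hc.neg

lemma gauge_sub_self_pos (hc : IsCompact K) (hne : (interior K).Nonempty) {x : E} (hx : x ≠ 0) :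
    0 < gauge (K - K) x :=
  (gauge_pos (absorbent_nhds_zero (sub_self_mem_nhds_zero hne))
    (NormedSpace.isVonNBounded_of_isBounded ℝ (isCompact_sub_self hc).isBounded)).2 hx

lemma mem_sub_self_of_gauge_le_one (hconv : Convex ℝ K) (hc : IsCompact K)
    (hne : (interior K).Nonempty) {x : E} (hx : gauge (K - K) x ≤ 1) : x ∈ K - K := by
  rw [gauge_le_one_iff_mem_closure (hconv.sub hconv) (sub_self_mem_nhds_zero hne)] at hx
  rwa [(isCompact_sub_self hc).isClosed.closure_eq] at hx

lemma exists_isLongestChord (hconv : Convex ℝ K) (hc : IsCompact K)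
    (hne : (interior K).Nonempty) {x : E} (hx : x ≠ 0) :
    ∃ a b, IsLongestChord K a b ∧ gauge (K - K) x • (a - b) = x := by
  have hpos := gauge_sub_self_pos hc hne hx
  have h1 : gauge (K - K) ((gauge (K - K) x)⁻¹ • x) = 1 := by
    rw [gauge_smul_of_nonneg (by positivity), smul_eq_mul, inv_mul_cancel₀ hpos.ne']
  obtain ⟨a, ha, b, hb, hab⟩ := mem_sub_self_of_gauge_le_one hconv hc hne h1.le
  have hab : a - b = (gauge (K - K) x)⁻¹ • x := hab
  exact ⟨a, b, ⟨ha, hb, by rw [hab, h1]⟩, by rw [hab, smul_inv_smul₀ hpos.ne']⟩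

end LongestChord

lemma IsLongestChord.isAffineDiameter {m : ℕ} {K : Set (EuclideanSpace ℝ (Fin m))}
    (hK : IsCompact K) {a b p : EuclideanSpace ℝ (Fin m)}
    (h : IsLongestChord K a b) (ℓ : ℙ ℝ (EuclideanSpace ℝ (Fin m)))
    (hℓ : ℓ.submodule = ℝ ∙ (a - b))
    (ha : a ∈ lineThrough ℓ p) (hb : b ∈ lineThrough ℓ p) :
    IsAffineDiameter K (lineThrough ℓ p) := by
  refine ⟨ℓ, p, rfl, fun u => ?_⟩
  have hle : dist a b ≤ chordLength K (lineThrough ℓ p) :=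
    Metric.dist_le_diam_of_mem (hK.isBounded.subset Set.inter_subset_left)
      ⟨h.left_mem, ha⟩ ⟨h.right_mem, hb⟩
  refine le_trans (Metric.diam_le_of_forall_dist_le dist_nonneg ?_) hle
  rintro y ⟨hyK, hy⟩ z ⟨hzK, hz⟩
  have hyz : y - z ∈ ℓ.submodule := by
    have := ℓ.submodule.sub_mem (AffineSubspace.mem_mk'.1 hy) (AffineSubspace.mem_mk'.1 hz)
    simpa using this
  rw [hℓ, Submodule.mem_span_singleton] at hyz
  obtain ⟨t, ht⟩ := hyz
  have hg : ∀ w, gauge (K - K) (|t| • w) = |t| * gauge (K - K) w := fun w => by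
    rw [gauge_smul_of_nonneg (abs_nonneg t), smul_eq_mul]
  have ht1 : |t| ≤ 1 := by
    have h1 : gauge (K - K) (y - z) ≤ 1 := gauge_le_one_of_mem ⟨y, hyK, z, hzK, rfl⟩
    have h2 : gauge (K - K) (|t| • (a - b)) = gauge (K - K) (y - z) := by
      rw [← ht]
      rcases abs_cases t with ⟨e, -⟩ | ⟨e, -⟩ <;> rw [e]
      rw [neg_smul, gauge_sub_self_neg]
    rw [hg, h.gauge_eq_one] at h2
    linarith
  rw [dist_eq_norm, dist_eq_norm, ← ht, norm_smul, Real.norm_eq_abs]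
  exact mul_le_of_le_one_left (norm_nonneg _) ht1

/-! ### Collapsing the complement of the interior of a convex body to a point -/

section Collapse

variable {m : ℕ}

/-- The vector `(r, y)` of `ℝ^(m+1) = ℝ × ℝ^m`. -/
noncomputable def consVec (r : ℝ) (y : EuclideanSpace ℝ (Fin m)) :
    EuclideanSpace ℝ (Fin (m + 1)) :=
  WithLp.toLp 2 (Fin.cons r fun i => y i)

/-- The last `m` coordinates of a vector of `ℝ^(m+1)`. -/
noncomputable def tailVec (v : EuclideanSpace ℝ (Fin (m + 1))) : EuclideanSpace ℝ (Fin m) :=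
  WithLp.toLp 2 fun i => v i.succ

@[simp] lemma consVec_zero (r : ℝ) (y : EuclideanSpace ℝ (Fin m)) : consVec r y 0 = r := rfl

@[simp] lemma tailVec_consVec (r : ℝ) (y : EuclideanSpace ℝ (Fin m)) :
    tailVec (consVec r y) = y := rfl

lemma norm_sq_eq_head_tail (v : EuclideanSpace ℝ (Fin (m + 1))) :
    ‖v‖ ^ 2 = v 0 ^ 2 + ‖tailVec v‖ ^ 2 := by
  simp [EuclideanSpace.norm_sq_eq, Fin.sum_univ_succ, tailVec]

lemma ext_head_tail {v w : EuclideanSpace ℝ (Fin (m + 1))} (h0 : v 0 = w 0)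
    (ht : tailVec v = tailVec w) : v = w := by
  ext i
  refine Fin.cases h0 (fun j => ?_) i
  exact congrArg (fun y : EuclideanSpace ℝ (Fin m) => y j) ht

lemma continuous_tailVec :
    Continuous (tailVec : EuclideanSpace ℝ (Fin (m + 1)) → EuclideanSpace ℝ (Fin m)) := by
  unfold tailVec; fun_prop

lemma tailVec_smul (t : ℝ) (v : EuclideanSpace ℝ (Fin (m + 1))) :
    tailVec (t • v) = t • tailVec v := rfl

lemma continuous_consVec :
    Continuous fun p : ℝ × EuclideanSpace ℝ (Fin m) => consVec p.1 p.2 := by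
  refine (PiLp.continuous_toLp 2 _).comp (continuous_pi fun i => ?_)
  refine Fin.cases ?_ (fun j => ?_) i
  · exact continuous_fst
  · simp only [Fin.cons_succ]; fun_prop

/-- A depth function of the body `K` seen from its interior point `c`: it is `1` at `c`, decreases
linearly along each ray from `c`, and vanishes on the boundary. -/
noncomputable def depth (K : Set (EuclideanSpace ℝ (Fin m))) (c x : EuclideanSpace ℝ (Fin m)) :
    ℝ :=
  1 - gauge ((fun y => c + y) ⁻¹' K) (x - c)

/-- The inverse stereographic projection of `(x - c) / depth K c x`, written without a division by
the depth. It embeds the interior of `K` into the sphere minus the pole `(1, 0)` and maps the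
boundary of `K` to the pole. -/
noncomputable def collapse (K : Set (EuclideanSpace ℝ (Fin m)))
    (c x : EuclideanSpace ℝ (Fin m)) : EuclideanSpace ℝ (Fin (m + 1)) :=
  consVec ((‖x - c‖ ^ 2 - depth K c x ^ 2) / (‖x - c‖ ^ 2 + depth K c x ^ 2))
    ((2 * (depth K c x / (‖x - c‖ ^ 2 + depth K c x ^ 2))) • (x - c))

variable {K : Set (EuclideanSpace ℝ (Fin m))} {c : EuclideanSpace ℝ (Fin m)}

lemma preimage_add_mem_nhds_zero (hc : c ∈ interior K) : (fun y => c + y) ⁻¹' K ∈ 𝓝 0 := by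
  apply (continuous_const_add c).continuousAt.preimage_mem_nhds
  simpa using mem_interior_iff_mem_nhds.1 hc

lemma depth_pos_iff (hconv : Convex ℝ K) (hc : c ∈ interior K) (x : EuclideanSpace ℝ (Fin m)) :
    0 < depth K c x ↔ x ∈ interior K := by
  rw [depth, sub_pos, gauge_lt_one_iff_mem_interior (hconv.translate_preimage_right c)
    (preimage_add_mem_nhds_zero hc), ← Homeomorph.coe_addLeft, ← Homeomorph.preimage_interior]
  simp

lemma depth_eq_zero (hconv : Convex ℝ K) (hc : c ∈ interior K) {x : EuclideanSpace ℝ (Fin m)}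
    (hx : x ∈ K) (hx' : x ∉ interior K) : depth K c x = 0 := by
  have h1 : 0 ≤ depth K c x :=
    sub_nonneg.2 (gauge_le_one_of_mem (by simpa using hx))
  have h2 := (depth_pos_iff hconv hc x).not.2 hx'
  linarith

lemma continuous_depth (hconv : Convex ℝ K) (hc : c ∈ interior K) : Continuous (depth K c) :=
  continuous_const.sub ((continuous_gauge (hconv.translate_preimage_right c)
    (preimage_add_mem_nhds_zero hc)).comp (continuous_id.sub continuous_const))

lemma collapse_denom_pos (K : Set (EuclideanSpace ℝ (Fin m))) (c x : EuclideanSpace ℝ (Fin m)) :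
    0 < ‖x - c‖ ^ 2 + depth K c x ^ 2 := by
  by_cases hx : x = c
  · simp [hx, depth]
  · have := norm_pos_iff.2 (sub_ne_zero.2 hx)
    positivity

lemma continuous_collapse (hconv : Convex ℝ K) (hc : c ∈ interior K) :
    Continuous (collapse K c) := by
  have hd := continuous_depth hconv hc
  have hden : ∀ x, ‖x - c‖ ^ 2 + depth K c x ^ 2 ≠ 0 := fun x => (collapse_denom_pos K c x).ne'
  refine continuous_consVec.comp (Continuous.prodMk ?_ ?_)
  · exact Continuous.div (by fun_prop) (by fun_prop) hden
  · exact (continuous_const.mul (hd.div (by fun_prop) hden)).smul (by fun_prop)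

lemma norm_collapse (K : Set (EuclideanSpace ℝ (Fin m))) (c x : EuclideanSpace ℝ (Fin m)) :
    ‖collapse K c x‖ = 1 := by
  have hden := collapse_denom_pos K c x
  have h : ‖collapse K c x‖ ^ 2 = 1 := by
    rw [norm_sq_eq_head_tail, collapse, consVec_zero, tailVec_consVec, norm_smul, mul_pow,
      Real.norm_eq_abs, sq_abs]
    field_simp
    ring
  nlinarith [norm_nonneg (collapse K c x)]

lemma collapse_eq_pole {x : EuclideanSpace ℝ (Fin m)} (hx : depth K c x = 0) :
    collapse K c x = consVec 1 0 := by
  have hden := collapse_denom_pos K c x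
  rw [hx] at hden
  simp only [collapse, hx]
  congr 1
  · simp only [ne_eq, OfNat.ofNat_ne_zero, not_false_eq_true, zero_pow, add_zero, sub_zero] at *
    exact div_self hden.ne'
  · simp

lemma collapse_zero_eq (K : Set (EuclideanSpace ℝ (Fin m))) (c x : EuclideanSpace ℝ (Fin m)) :
    collapse K c x 0 =
      1 - 2 * (depth K c x / (‖x - c‖ ^ 2 + depth K c x ^ 2)) * depth K c x := by
  have hden := collapse_denom_pos K c x
  rw [collapse, consVec_zero]
  field_simp
  ring

lemma collapse_ne_pole {x : EuclideanSpace ℝ (Fin m)} (hx : 0 < depth K c x) :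
    collapse K c x ≠ consVec 1 0 := by
  intro h
  have h0 := congrArg (fun v : EuclideanSpace ℝ (Fin (m + 1)) => v 0) h
  simp only [collapse_zero_eq, consVec_zero] at h0
  have hden := collapse_denom_pos K c x
  have : 0 < 2 * (depth K c x / (‖x - c‖ ^ 2 + depth K c x ^ 2)) * depth K c x := by positivity
  linarith

lemma eq_of_collapse_eq {x y : EuclideanSpace ℝ (Fin m)} (hx : 0 < depth K c x)
    (hy : 0 < depth K c y) (h : collapse K c x = collapse K c y) : x = y := by
  have h0 := congrArg (fun v : EuclideanSpace ℝ (Fin (m + 1)) => v 0) h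
  have ht := congrArg tailVec h
  simp only [collapse_zero_eq] at h0
  simp only [collapse, tailVec_consVec] at ht
  have hkx : 0 < 2 * (depth K c x / (‖x - c‖ ^ 2 + depth K c x ^ 2)) := by
    have := collapse_denom_pos K c x
    positivity
  have hky : 0 < 2 * (depth K c y / (‖y - c‖ ^ 2 + depth K c y ^ 2)) := by
    have := collapse_denom_pos K c y
    positivity
  have hdx : depth K c x = 1 - gauge ((fun y => c + y) ⁻¹' K) (x - c) := rfl
  have hdy : depth K c y = 1 - gauge ((fun y => c + y) ⁻¹' K) (y - c) := rfl
  generalize 2 * (depth K c x / (‖x - c‖ ^ 2 + depth K c x ^ 2)) = k at *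
  generalize 2 * (depth K c y / (‖y - c‖ ^ 2 + depth K c y ^ 2)) = l at *
  have hkl : k * depth K c x = l * depth K c y := by linarith
  -- Both points lie on one ray from `c`, so applying the gauge to `ht` shows `k = l`.
  have hg := congrArg (gauge ((fun y => c + y) ⁻¹' K)) ht
  rw [gauge_smul_of_nonneg hkx.le, gauge_smul_of_nonneg hky.le, smul_eq_mul, smul_eq_mul] at hg
  have : k = l := by
    rw [hdx, hdy] at hkl
    linarith
  subst this
  exact sub_left_injective (smul_right_injective _ hkx.ne' ht)

end Collapse

/-! ### The map from projective space -/

section ProjectiveMap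

variable {m : ℕ} {K : Set (EuclideanSpace ℝ (Fin m))} {c : EuclideanSpace ℝ (Fin m)}

/-- `(a, b)` is a longest chord of `K` directed along the last `m` coordinates of `v`. If these
vanish, every longest chord is admitted. This makes the relation closed in `(v, a, b)`. -/
def IsChordFor (K : Set (EuclideanSpace ℝ (Fin m))) (v : EuclideanSpace ℝ (Fin (m + 1)))
    (a b : EuclideanSpace ℝ (Fin m)) : Prop :=
  IsLongestChord K a b ∧ gauge (K - K) (tailVec v) • (a - b) = tailVec v

/-- The point dividing the chord from `b` to `a` at the parameter `v 0 / ‖v‖ ∈ [-1, 1]`, where `-1`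
corresponds to `b` and `1` to `a`. -/
noncomputable def chordPoint (v : EuclideanSpace ℝ (Fin (m + 1)))
    (a b : EuclideanSpace ℝ (Fin m)) : EuclideanSpace ℝ (Fin m) :=
  ((1 + v 0 / ‖v‖) / 2) • a + ((1 - v 0 / ‖v‖) / 2) • b

lemma IsChordFor.unique (hs : StrictConvex ℝ K) (hK : IsCompact K)
    (hne : (interior K).Nonempty) {v w : EuclideanSpace ℝ (Fin (m + 1))}
    {a b a' b' : EuclideanSpace ℝ (Fin m)} (hv : tailVec v ≠ 0) (hvw : tailVec v = tailVec w)
    (h : IsChordFor K v a b) (h' : IsChordFor K w a' b') : a = a' ∧ b = b' := by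
  have hab : a - b = a' - b' := by
    have h1 := h'.2
    rw [← hvw] at h1
    exact smul_right_injective _ (gauge_sub_self_pos hK hne hv).ne' (h.2.trans h1.symm)
  have ha := h.1.left_unique hs h'.1 hab
  refine ⟨ha, ?_⟩
  rw [ha] at hab
  exact sub_right_injective hab

/-- Rescaling `v` by a negative number reverses the chord and the sign of its parameter. -/
lemma IsChordFor.exists_smul {v : EuclideanSpace ℝ (Fin (m + 1))}
    {a b : EuclideanSpace ℝ (Fin m)} (h : IsChordFor K v a b) {t : ℝ} (ht : t ≠ 0) :
    ∃ a' b', IsChordFor K (t • v) a' b' ∧ chordPoint (t • v) a' b' = chordPoint v a b := by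
  rcases lt_or_gt_of_ne ht with ht | ht
  · refine ⟨b, a, ⟨h.1.swap, ?_⟩, ?_⟩
    · have h1 : tailVec (t • v) = -((-t) • tailVec v) := by rw [tailVec_smul]; module
      rw [h1, gauge_sub_self_neg, gauge_smul_of_nonneg (by linarith), smul_assoc,
        ← neg_sub a b, smul_neg, h.2, smul_neg]
    · have h1 : (t • v) 0 / ‖t • v‖ = -(v 0 / ‖v‖) := by
        rw [norm_smul, Real.norm_eq_abs, abs_of_neg ht, PiLp.smul_apply, smul_eq_mul, neg_mul,
          div_neg, mul_div_mul_left _ _ ht.ne]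
      rw [chordPoint, chordPoint, h1, add_comm]
      congr 2; ring
  · refine ⟨a, b, ⟨h.1, ?_⟩, ?_⟩
    · rw [tailVec_smul, gauge_smul_of_nonneg ht.le, smul_assoc, h.2]
    · have h1 : (t • v) 0 / ‖t • v‖ = v 0 / ‖v‖ := by
        rw [norm_smul, Real.norm_eq_abs, abs_of_pos ht, PiLp.smul_apply, smul_eq_mul,
          mul_div_mul_left _ _ ht.ne']
      rw [chordPoint, chordPoint, h1]

lemma one_sub_div_norm_sq {v : EuclideanSpace ℝ (Fin (m + 1))} (hv : v ≠ 0) :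
    1 - (v 0 / ‖v‖) ^ 2 = ‖tailVec v‖ ^ 2 / ‖v‖ ^ 2 := by
  have := norm_pos_iff.2 hv
  have h := norm_sq_eq_head_tail v
  field_simp
  linarith

lemma chordPoint_mem_interior (hs : StrictConvex ℝ K) {v : EuclideanSpace ℝ (Fin (m + 1))}
    {a b : EuclideanSpace ℝ (Fin m)} (hv : tailVec v ≠ 0) (h : IsLongestChord K a b) :
    chordPoint v a b ∈ interior K := by
  have hv0 : v ≠ 0 := by rintro rfl; exact hv rfl
  have h1 := one_sub_div_norm_sq hv0
  have h2 : 0 < ‖tailVec v‖ ^ 2 / ‖v‖ ^ 2 := by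
    have := norm_pos_iff.2 hv
    have := norm_pos_iff.2 hv0
    positivity
  have h3 : |v 0 / ‖v‖| < 1 := by rw [← sq_lt_one_iff_abs_lt_one]; linarith
  rw [abs_lt] at h3
  exact hs h.left_mem h.right_mem h.ne (by linarith) (by linarith) (by ring)

lemma chordPoint_of_tailVec_eq_zero {v : EuclideanSpace ℝ (Fin (m + 1))}
    (hv0 : v ≠ 0) (hv : tailVec v = 0) (a b : EuclideanSpace ℝ (Fin m)) :
    chordPoint v a b = a ∨ chordPoint v a b = b := by
  have h1 : (v 0 / ‖v‖) ^ 2 = 1 := by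
    have := one_sub_div_norm_sq hv0
    simp only [hv, norm_zero, ne_eq, OfNat.ofNat_ne_zero, not_false_eq_true, zero_pow,
      zero_div] at this
    linarith
  rcases sq_eq_one_iff.1 h1 with h | h
  · left; rw [chordPoint, h]; norm_num
  · right; rw [chordPoint, h]; norm_num

lemma collapse_chordPoint_of_tailVec_eq_zero (hconv : Convex ℝ K) (hc : c ∈ interior K)
    {v : EuclideanSpace ℝ (Fin (m + 1))} {a b : EuclideanSpace ℝ (Fin m)}
    (hv0 : v ≠ 0) (hv : tailVec v = 0) (h : IsLongestChord K a b) :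
    collapse K c (chordPoint v a b) = consVec 1 0 := by
  apply collapse_eq_pole
  rcases chordPoint_of_tailVec_eq_zero hv0 hv a b with e | e <;> rw [e]
  · exact depth_eq_zero hconv hc h.left_mem h.left_notMem_interior
  · exact depth_eq_zero hconv hc h.right_mem h.right_notMem_interior

/-- The point of the sphere attached to `v` depends neither on the chord chosen for `v` nor on the
scale of `v`. -/
lemma collapse_chordPoint_eq (hs : StrictConvex ℝ K) (hK : IsCompact K) (hc : c ∈ interior K)
    {v : EuclideanSpace ℝ (Fin (m + 1))} {a b a' b' : EuclideanSpace ℝ (Fin m)} {t : ℝ}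
    (ht : t ≠ 0) (hv0 : v ≠ 0) (h : IsChordFor K v a b) (h' : IsChordFor K (t • v) a' b') :
    collapse K c (chordPoint (t • v) a' b') = collapse K c (chordPoint v a b) := by
  by_cases hv : tailVec v = 0
  · rw [collapse_chordPoint_of_tailVec_eq_zero hs.convex hc hv0 hv h.1,
      collapse_chordPoint_of_tailVec_eq_zero hs.convex hc (smul_ne_zero ht hv0)
        (by rw [tailVec_smul, hv, smul_zero]) h'.1]
  · obtain ⟨a'', b'', h'', e⟩ := h.exists_smul ht
    have hv' : tailVec (t • v) ≠ 0 := by rw [tailVec_smul]; exact smul_ne_zero ht hv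
    obtain ⟨rfl, rfl⟩ := h'.unique hs hK ⟨c, hc⟩ hv' rfl h''
    rw [e]

lemma exists_isChordFor [NeZero m] (hconv : Convex ℝ K) (hK : IsCompact K)
    (hne : (interior K).Nonempty) (v : EuclideanSpace ℝ (Fin (m + 1))) :
    ∃ a b, IsChordFor K v a b := by
  by_cases hv : tailVec v = 0
  · obtain ⟨x, hx⟩ := exists_ne (0 : EuclideanSpace ℝ (Fin m))
    obtain ⟨a, b, h, -⟩ := exists_isLongestChord hconv hK hne hx
    exact ⟨a, b, h, by simp [hv]⟩
  · exact exists_isLongestChord hconv hK hne hv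

/-- Two nonzero vectors on the axis span the same point of projective space. -/
lemma mk_eq_mk_of_tailVec_eq_zero {v w : EuclideanSpace ℝ (Fin (m + 1))} (hv : v ≠ 0)
    (hw : w ≠ 0) (hv' : tailVec v = 0) (hw' : tailVec w = 0) :
    Projectivization.mk ℝ v hv = Projectivization.mk ℝ w hw := by
  have hw0 : w 0 ≠ 0 := fun h => hw (ext_head_tail h hw')
  refine (Projectivization.mk_eq_mk_iff' ℝ v w hv hw).2 ⟨v 0 / w 0, ext_head_tail ?_ ?_⟩
  · rw [PiLp.smul_apply, smul_eq_mul, div_mul_cancel₀ _ hw0]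
  · rw [tailVec_smul, hw', hv', smul_zero]

/-- A map that is a function of a closed relation with compact values, through a continuous
function, is continuous. -/
lemma continuous_of_isClosed_relation {X Y Z : Type*} [TopologicalSpace X] [TopologicalSpace Y]
    [TopologicalSpace Z] {C : Set Z} (hC : IsCompact C) {T : Set (X × Z)} (hT : IsClosed T)
    (hTC : ∀ p ∈ T, p.2 ∈ C) (hne : ∀ x, ∃ z, (x, z) ∈ T) {g : X × Z → Y} (hg : Continuous g)
    {f : X → Y} (hf : ∀ p ∈ T, f p.1 = g p) : Continuous f := by
  have := isCompact_iff_compactSpace.1 hC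
  refine continuous_iff_isClosed.2 fun S hS => ?_
  have hcl : IsClosed {p : X × C | (p.1, (p.2 : Z)) ∈ T ∧ g (p.1, (p.2 : Z)) ∈ S} := by
    have hi : Continuous fun p : X × C => (p.1, (p.2 : Z)) := by fun_prop
    exact (hT.preimage hi).inter (hS.preimage (hg.comp hi))
  convert isClosedMap_fst_of_compactSpace _ hcl using 1
  ext x
  constructor
  · intro hx
    obtain ⟨z, hz⟩ := hne x
    refine ⟨(x, ⟨z, hTC _ hz⟩), ⟨hz, ?_⟩, rfl⟩
    rw [← hf _ hz]
    exact hx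
  · rintro ⟨⟨x, z⟩, ⟨hz, hzS⟩, rfl⟩
    rw [← hf _ hz] at hzS
    exact hzS

lemma isClosed_isChordFor (hconv : Convex ℝ K) (hK : IsCompact K) (hne : (interior K).Nonempty) :
    IsClosed {p : {v : EuclideanSpace ℝ (Fin (m + 1)) // v ≠ 0} ×
      (EuclideanSpace ℝ (Fin m) × EuclideanSpace ℝ (Fin m)) |
      IsChordFor K p.1 p.2.1 p.2.2} := by
  have hg : Continuous (gauge (K - K)) :=
    continuous_gauge (hconv.sub hconv) (sub_self_mem_nhds_zero hne)
  have ht := continuous_tailVec (m := m)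
  have h1 := hK.isClosed.preimage (f := fun p : {v : EuclideanSpace ℝ (Fin (m + 1)) // v ≠ 0} ×
      (EuclideanSpace ℝ (Fin m) × EuclideanSpace ℝ (Fin m)) => p.2.1) (by fun_prop)
  have h2 := hK.isClosed.preimage (f := fun p : {v : EuclideanSpace ℝ (Fin (m + 1)) // v ≠ 0} ×
      (EuclideanSpace ℝ (Fin m) × EuclideanSpace ℝ (Fin m)) => p.2.2) (by fun_prop)
  have h3 := isClosed_eq (f := fun p : {v : EuclideanSpace ℝ (Fin (m + 1)) // v ≠ 0} ×
      (EuclideanSpace ℝ (Fin m) × EuclideanSpace ℝ (Fin m)) => gauge (K - K) (p.2.1 - p.2.2))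
      (g := fun _ => 1) (by fun_prop) (by fun_prop)
  have h4 := isClosed_eq (f := fun p : {v : EuclideanSpace ℝ (Fin (m + 1)) // v ≠ 0} ×
      (EuclideanSpace ℝ (Fin m) × EuclideanSpace ℝ (Fin m)) =>
        gauge (K - K) (tailVec p.1) • (p.2.1 - p.2.2))
      (g := fun p => tailVec p.1) (by fun_prop) (by fun_prop)
  convert (h1.inter h2).inter (h3.inter h4) using 1
  ext p
  exact ⟨fun h => ⟨⟨h.1.1, h.1.2⟩, h.1.3, h.2⟩, fun h => ⟨⟨h.1.1, h.1.2, h.2.1⟩, h.2.2⟩⟩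

/-- Every vector carries a chord, and the resulting points of the sphere fit together to a
continuous map on projective space. -/
lemma exists_continuousMap [NeZero m] (hs : StrictConvex ℝ K) (hK : IsCompact K)
    (hc : c ∈ interior K) :
    ∃ f : C(RealProjectiveSpace m, Metric.sphere (0 : EuclideanSpace ℝ (Fin (m + 1))) 1),
      ∀ (v : EuclideanSpace ℝ (Fin (m + 1))) (hv : v ≠ 0) (a b : EuclideanSpace ℝ (Fin m)),
        IsChordFor K v a b →
        (f (Projectivization.mk ℝ v hv) : EuclideanSpace ℝ (Fin (m + 1))) =
          collapse K c (chordPoint v a b) := by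
  choose A B hAB using exists_isChordFor hs.convex hK ⟨c, hc⟩
  let F : RealProjectiveSpace m → Metric.sphere (0 : EuclideanSpace ℝ (Fin (m + 1))) 1 :=
    fun P => ⟨collapse K c (chordPoint (Projectivization.rep P)
      (A (Projectivization.rep P)) (B (Projectivization.rep P))),
      mem_sphere_zero_iff_norm.2 (norm_collapse _ _ _)⟩
  have hF : ∀ (v : EuclideanSpace ℝ (Fin (m + 1))) (hv : v ≠ 0) (a b : EuclideanSpace ℝ (Fin m)),
      IsChordFor K v a b →
      (F (Projectivization.mk ℝ v hv) : EuclideanSpace ℝ (Fin (m + 1))) =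
        collapse K c (chordPoint v a b) := by
    intro v hv a b h
    obtain ⟨t, ht⟩ := Projectivization.exists_smul_eq_mk_rep ℝ v hv
    have ht : (t : ℝ) • v = (Projectivization.mk ℝ v hv).rep := ht
    simp only [F, ← ht]
    exact collapse_chordPoint_eq hs hK hc t.ne_zero hv h (hAB _)
  refine ⟨⟨F, ?_⟩, hF⟩
  refine continuous_coinduced_dom.2 (Continuous.subtype_mk (f := fun v =>
    (F (Projectivization.mk' ℝ v) : EuclideanSpace ℝ (Fin (m + 1)))) ?_ _)
  refine continuous_of_isClosed_relation (hK.prod hK)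
    (isClosed_isChordFor hs.convex hK ⟨c, hc⟩) (fun p hp => ⟨hp.1.1, hp.1.2⟩)
    (fun v => ⟨(A v, B v), hAB v⟩)
    (g := fun p => collapse K c (chordPoint p.1 p.2.1 p.2.2)) ?_
    (fun p hp => hF p.1 p.1.2 _ _ hp)
  have hq : Continuous fun p : {v : EuclideanSpace ℝ (Fin (m + 1)) // v ≠ 0} ×
      (EuclideanSpace ℝ (Fin m) × EuclideanSpace ℝ (Fin m)) =>
      (p.1 : EuclideanSpace ℝ (Fin (m + 1))) 0 / ‖(p.1 : EuclideanSpace ℝ (Fin (m + 1)))‖ :=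
    Continuous.div (by fun_prop) (by fun_prop) fun p => norm_ne_zero_iff.2 p.1.2
  refine (continuous_collapse hs.convex hc).comp ?_
  unfold chordPoint
  fun_prop

/-- A point of projective space off the axis is determined by the direction of its chord together
with its point on that chord. -/
lemma mk_eq_mk_of_chordPoint_eq (hs : StrictConvex ℝ K) (hK : IsCompact K)
    (hne : (interior K).Nonempty) {v w : EuclideanSpace ℝ (Fin (m + 1))} (hv : v ≠ 0) (hw : w ≠ 0)
    (hv' : tailVec v ≠ 0) {t : ℝ} (ht : t • tailVec w = tailVec v)
    {a b a' b' : EuclideanSpace ℝ (Fin m)} (h : IsChordFor K v a b) (h' : IsChordFor K w a' b')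
    (hp : chordPoint v a b = chordPoint w a' b') :
    Projectivization.mk ℝ v hv = Projectivization.mk ℝ w hw := by
  have ht0 : t ≠ 0 := by
    rintro rfl
    exact hv' (by rw [← ht, zero_smul])
  refine (Projectivization.mk_eq_mk_iff' ℝ v w hv hw).2 ⟨t, ?_⟩
  obtain ⟨a'', b'', h'', e⟩ := h'.exists_smul ht0
  have htail : tailVec v = tailVec (t • w) := ht.symm
  have hu0 : t • w ≠ 0 := smul_ne_zero ht0 hw
  rw [← e] at hp
  generalize t • w = u at *
  obtain ⟨rfl, rfl⟩ := h.unique hs hK hne hv' htail h''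
  have hdir : ((v 0 / ‖v‖ - u 0 / ‖u‖) / 2) • (a - b) = 0 := by
    rw [← sub_eq_zero.2 hp, chordPoint, chordPoint]
    module
  have hs : v 0 / ‖v‖ = u 0 / ‖u‖ := by
    rcases smul_eq_zero.1 hdir with h0 | h0
    · linarith
    · exact absurd (sub_eq_zero.1 h0) h.1.ne
  -- The parameter and the norm of the tail determine the norm, hence the first coordinate.
  have hnv := norm_pos_iff.2 hv
  have hnu := norm_pos_iff.2 hu0
  have hnorm : ‖v‖ = ‖u‖ := by
    have h1 := one_sub_div_norm_sq hv
    have h2 := one_sub_div_norm_sq hu0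
    have h3 := norm_pos_iff.2 hv'
    rw [← hs, h1, ← htail, div_eq_div_iff (by positivity) (by positivity)] at h2
    have h4 := mul_left_cancel₀ (by positivity) h2
    exact ((sq_eq_sq₀ hnv.le hnu.le).1 h4.symm)
  refine (ext_head_tail ?_ htail).symm
  rw [hnorm] at hs
  exact (div_left_inj' hnu.ne').1 hs

end ProjectiveMap

theorem theorem1p9 (m : ℕ) (K : Set (EuclideanSpace ℝ (Fin m)))
    (hK : IsConvexBody K) (hstrict : StrictConvex ℝ K) :
    ∃ f : C(RealProjectiveSpace m, Metric.sphere (0 : EuclideanSpace ℝ (Fin (m + 1))) 1),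
      ∀ k : ℕ, 2 ≤ k → AdmitsMultiplicity f k →
        ∃ L : Fin k → AffineSubspace ℝ (EuclideanSpace ℝ (Fin m)),
          Function.Injective L ∧
          (∀ i, IsAffineDiameter K (L i)) ∧
          ((⋂ i, (L i : Set (EuclideanSpace ℝ (Fin m)))) ∩ interior K).Nonempty := by
  obtain ⟨c, hc⟩ := hK.nonempty_interior
  rcases eq_or_ne m 0 with rfl | hm
  · -- `ℝP^0` is a single point, so no map on it has a multiple value.
    refine ⟨ContinuousMap.const _ ⟨collapse K c c, mem_sphere_zero_iff_norm.2
      (norm_collapse K c c)⟩, fun k hk hmult => ?_⟩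
    obtain ⟨x, hx, -⟩ := hmult
    have hsub : ∀ P Q : RealProjectiveSpace 0, P = Q := fun P Q =>
        Projectivization.ind (fun v hv => Projectivization.ind (fun w hw =>
          mk_eq_mk_of_tailVec_eq_zero hv hw (Subsingleton.elim _ _) (Subsingleton.elim _ _)) Q) P
    have := hx (hsub (x ⟨0, by omega⟩) (x ⟨1, by omega⟩))
    simp at this
  have : NeZero m := ⟨hm⟩
  obtain ⟨f, hf⟩ := exists_continuousMap hstrict hK.isCompact hc
  refine ⟨f, fun k hk ⟨x, hx, hfx⟩ => ?_⟩
  have hrep : ∀ i, ∃ (v : EuclideanSpace ℝ (Fin (m + 1))) (hv : v ≠ 0),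
      x i = Projectivization.mk ℝ v hv := fun i =>
    ⟨_, Projectivization.rep_nonzero (x i), (Projectivization.mk_rep (x i)).symm⟩
  choose v hv hxv using hrep
  choose a b hab using fun i =>
    exists_isChordFor hstrict.convex hK.isCompact hK.nonempty_interior (v i)
  have hval : ∀ i, (f (x i) : EuclideanSpace ℝ (Fin (m + 1))) =
      collapse K c (chordPoint (v i) (a i) (b i)) := fun i => by
    rw [hxv i]; exact hf _ _ _ _ (hab i)
  have hcol : ∀ i j, collapse K c (chordPoint (v i) (a i) (b i)) =
      collapse K c (chordPoint (v j) (a j) (b j)) := fun i j => by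
    rw [← hval i, ← hval j, hfx i j]
  have hdepth : ∀ i, tailVec (v i) ≠ 0 → 0 < depth K c (chordPoint (v i) (a i) (b i)) :=
    fun i hi => (depth_pos_iff hstrict.convex hc _).2 (chordPoint_mem_interior hstrict hi (hab i).1)
  -- The pole of the sphere has a single preimage, so none of the `k ≥ 2` points is on the axis.
  have htail : ∀ i, tailVec (v i) ≠ 0 := by
    intro i hi
    have hall : ∀ j, tailVec (v j) = 0 := by
      intro j
      by_contra hj
      refine collapse_ne_pole (hdepth j hj) ?_
      rw [hcol j i]
      exact collapse_chordPoint_of_tailVec_eq_zero hstrict.convex hc (hv i) hi (hab i).1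
    have h01 : x ⟨0, by omega⟩ = x ⟨1, by omega⟩ := by
      rw [hxv, hxv]
      exact mk_eq_mk_of_tailVec_eq_zero _ _ (hall _) (hall _)
    have := hx h01
    simp at this
  have hpt : ∀ i j, chordPoint (v i) (a i) (b i) = chordPoint (v j) (a j) (b j) := fun i j =>
    eq_of_collapse_eq (hdepth i (htail i)) (hdepth j (htail j)) (hcol i j)
  let i₀ : Fin k := ⟨0, by omega⟩
  let p := chordPoint (v i₀) (a i₀) (b i₀)
  have hp : ∀ i, chordPoint (v i) (a i) (b i) = p := fun i => hpt i i₀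
  let ℓ : Fin k → ℙ ℝ (EuclideanSpace ℝ (Fin m)) := fun i =>
    Projectivization.mk ℝ (tailVec (v i)) (htail i)
  have hℓ : ∀ i, (ℓ i).submodule = ℝ ∙ (a i - b i) := fun i => by
    rw [Projectivization.submodule_mk, ← (hab i).2]
    exact Submodule.span_singleton_smul_eq
      (gauge_sub_self_pos hK.isCompact hK.nonempty_interior (htail i)).ne'.isUnit _
  refine ⟨fun i => lineThrough (ℓ i) p, fun i j hij => ?_, fun i => ?_, p, ?_, ?_⟩
  · have hdir : (ℓ i).submodule = (ℓ j).submodule := by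
      simpa [lineThrough] using congrArg AffineSubspace.direction hij
    obtain ⟨t, ht⟩ := (Projectivization.mk_eq_mk_iff' ℝ _ _ _ _).1
      (Projectivization.submodule_injective hdir)
    apply hx
    rw [hxv i, hxv j]
    exact mk_eq_mk_of_chordPoint_eq hstrict hK.isCompact hK.nonempty_interior (hv i) (hv j)
      (htail i) ht (hab i) (hab j) (hpt i j)
  · refine (hab i).1.isAffineDiameter hK.isCompact (ℓ i) (hℓ i) ?_ ?_
    · rw [lineThrough, AffineSubspace.mem_mk', hℓ, Submodule.mem_span_singleton]
      refine ⟨(1 - v i 0 / ‖v i‖) / 2, ?_⟩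
      rw [← hp i, chordPoint, vsub_eq_sub]
      module
    · rw [lineThrough, AffineSubspace.mem_mk', hℓ, Submodule.mem_span_singleton]
      refine ⟨-((1 + v i 0 / ‖v i‖) / 2), ?_⟩
      rw [← hp i, chordPoint, vsub_eq_sub]
      module
  · exact Set.mem_iInter.2 fun i => AffineSubspace.self_mem_mk' _ _
  · exact chordPoint_mem_interior hstrict (htail i₀) (hab i₀).1
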